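/- \textbf{Theorem (Average-case security).} Let $q\ge 1$, $m\ge 3$ and $n\ge 19$ be integers. The $m$-parallel IKOS protocol over $\mathbb{Z}_q$ with $n$ users is the randomized map $\mathcal{V}_{m,n}:\mathbb{Z}_q^n\to(\mathbb{Z}_q^n)^m$ defined as follows. On input $(x_1,\dots,x_n)$, each user $i$ independently draws a tuple $(Y_i^{(1)},\dots,Y_i^{(m)})$ of uniform random elements of $\mathbb{Z}_q$ conditioned on $\sum_{j=1}^m Y_i^{(j)}=x_i$; then, for each $j$, the tuple $(Y_1^{(j)},\dots,Y_n^{(j)})$ is permuted by a uniform random permutation of $\{1,\dots,n\}$, the $m$ permutations being independent of each other and of the shares; the output consists of the $m$ permuted tuples, in the order $j=1,\dots,m$. Put $$\sigma=\frac{(m-1)(\log_2 n-\log_2 e)-\log_2 q}{2}$$ and suppose that $\sigma\ge 1$. Then $\mathcal{V}_{m,n}$ provides average-case statistical security with parameter $\sigma$, that is, $$\mathbb{E}_{X,X'}\big[\mathfrak{T}(\mathcal{V}_{m,n}(X),\mathcal{V}_{m,n}(X'))\big]\le 2^{-\sigma},$$ where $X$ and $X'$ are $n$-tuples of uniform random elements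 of $\mathbb{Z}_q$ conditioned on $\sum_{i=1}^n X_i=\sum_{i=1}^n X'_i$, and, for each fixed value of $(X,X')$, $\mathfrak{T}(P,Q)=\sup_E|P(E)-Q(E)|$ denotes the total variation distance between the two output distributions, taken over the randomness of the protocol only. -/

import Mathlib

noncomputable section

/-- The law of a family of independent random variables `Y i`, where `Y i` has law `p i`. -/
def indepPMF {ι α : Type*} [Fintype ι] [DecidableEq ι] [Fintype α] (p : ι → PMF α) :
    PMF (ι → α) :=
  PMF.ofFintype (fun y => ∏ i, p i (y i)) (by
    have h := Finset.prod_univ_sum (fun _ : ι => (Finset.univ : Finset α)) (fun i a => p i a)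
    rw [Fintype.piFinset_univ] at h
    rw [← h]
    refine Finset.prod_eq_one fun i _ => ?_
    rw [← tsum_fintype (L := SummationFilter.unconditional α)]
    exact (p i).tsum_coe)

/-- The `m`-tuples of additive shares of `x`. -/
def shareTuples {G : Type*} [AddCommGroup G] [Fintype G] [DecidableEq G] (m : ℕ) (x : G) :
    Finset (Fin m → G) :=
  Finset.univ.filter fun y => ∑ j, y j = x

theorem shareTuples_nonempty {G : Type*} [AddCommGroup G] [Fintype G] [DecidableEq G]
    (m : ℕ) [NeZero m] (x : G) : (shareTuples m x).Nonempty :=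
  ⟨Pi.single 0 x, by simp [shareTuples]⟩

/-- The local randomizer `R_m`: on input `x`, a tuple of `m` uniform random elements of `G`
conditioned on having sum `x`. -/
def shareRandomizer {G : Type*} [AddCommGroup G] [Fintype G] [DecidableEq G]
    (m : ℕ) [NeZero m] (x : G) : PMF (Fin m → G) :=
  PMF.uniformOfFinset (shareTuples m x) (shareTuples_nonempty m x)

/-- The shuffler: apply a uniform random permutation of `Fin n` to an `n`-tuple. -/
def shuffler {G : Type*} (n : ℕ) (y : Fin n → G) : PMF (Fin n → G) :=
  (PMF.uniformOfFintype (Equiv.Perm (Fin n))).map fun π : Equiv.Perm (Fin n) => fun i => y (π i)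

/-- The `m`-parallel IKOS protocol with `n` users over `G`, identified with the view of the
aggregator. Every user `i` independently draws shares `y i 0, …, y i (m - 1)` of the input `x i`,
and then, for each `j`, the `j`-th shares of all the users pass through their own shuffler, the
`m` shufflers being independent. The value at `j` of the resulting random element is the output
of the `j`-th shuffler. -/
def parallelIKOS (G : Type*) [AddCommGroup G] [Fintype G] [DecidableEq G]
    (m n : ℕ) [NeZero m] (x : Fin n → G) : PMF (Fin m → Fin n → G) :=
  (indepPMF fun i => shareRandomizer m (x i)).bind fun y =>
    indepPMF fun j => shuffler n fun i => y i j

/-- Total variation distance `sup_E |P(E) - Q(E)|`, the supremum being over all events. -/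
def tvDistance {Ω : Type*} (P Q : PMF Ω) : ℝ :=
  ⨆ E : Set Ω, |(P.toOuterMeasure E).toReal - (Q.toOuterMeasure E).toReal|

/-- The pairs of `n`-tuples over `G` with equal sums. -/
def equalSumPairs (G : Type*) [AddCommGroup G] [Fintype G] [DecidableEq G] (n : ℕ) :
    Finset ((Fin n → G) × (Fin n → G)) :=
  Finset.univ.filter fun p => ∑ i, p.1 i = ∑ i, p.2 i

theorem equalSumPairs_nonempty (G : Type*) [AddCommGroup G] [Fintype G] [DecidableEq G] (n : ℕ) :
    (equalSumPairs G n).Nonempty :=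
  ⟨0, by simp [equalSumPairs]⟩

/-- The law of a pair `(X, X')` of `n`-tuples of uniform random elements of `G` conditioned on
the sum of `X` being equal to the sum of `X'`. -/
def inputPairLaw (G : Type*) [AddCommGroup G] [Fintype G] [DecidableEq G] (n : ℕ) :
    PMF ((Fin n → G) × (Fin n → G)) :=
  PMF.uniformOfFinset (equalSumPairs G n) (equalSumPairs_nonempty G n)

/-- The randomized map `V` with domain `G ^ n` provides average-case statistical security with
parameter `σ`: the expectation over `(X, X')` of the total variation distance between `V X` and
`V X'` (for fixed inputs, so over the randomness of `V` only) is at most `2 ^ (-σ)`. -/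
def AverageCaseSecure {G Ω : Type*} [AddCommGroup G] [Fintype G] [DecidableEq G] {n : ℕ}
    (V : (Fin n → G) → PMF Ω) (σ : ℝ) : Prop :=
  ∑ p : (Fin n → G) × (Fin n → G),
    (inputPairLaw G n p).toReal * tvDistance (V p.1) (V p.2) ≤ (2 : ℝ) ^ (-σ)

end

/-! An output `v` has the same total sum as its input, and its probability given `x` is proportional
to the number of families of permutations that unshuffle `v` into shares of `x`. Total variation is
at most half the ℓ¹ distance, and Cauchy–Schwarz over triples `(x, x', v)` with equal sums
(`sq_sum_abs_sub_le`) leaves a second moment, which counts pairs of families giving the same user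
sums from `v`.

Character orthogonality (`card_rows_eq`) turns this count into a sum over `f : Fin n → ZMod q` of
the `m`-th power of the stabilizer order of `f`. The `q` constant functions give the main term,
which cancels exactly against the square of the mean.

The full sum is `n!` times a coefficient of `(∑ k! ^ r z ^ k) ^ q` with `r = m - 1`
(`sum_stabCard_pow`). Since factorials are log-convex, the nonconstant `f` add at most a relative
`2u`, where `u = q (e / n) ^ (m - 1) = 2 ^ (-2σ)` (`coeff_factorialPowSeries_pow_le`). The squared
expectation is then at most `u`. -/

/-! ### Stabilizer orders and power series -/

open Finset Nat in
/-- Summing a product weight of the fibre sizes over all functions `Fin n → β`. -/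
theorem sum_prod_fiber_weight {β : Type*} [Fintype β] [DecidableEq β] (n : ℕ) (w : ℕ → ℕ) :
    ∑ f : Fin n → β, ∏ b, w (Fintype.card {i // f i = b}) =
      ∑ k ∈ piAntidiag (univ : Finset β) n, multinomial univ k * ∏ b, w (k b) := by
  -- The linear functional sending the monomial with exponents `k` to its weight; applied to both
  -- expansions of `(∑ b, X b) ^ n`, it yields the identity.
  let L := (MvPolynomial.basisMonomials β ℕ).constr ℕ (fun k : β →₀ ℕ => ∏ b, w (k b))
  have hL : ∀ k : β →₀ ℕ, L (MvPolynomial.monomial k 1) = ∏ b, w (k b) := fun k => by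
    have := (MvPolynomial.basisMonomials β ℕ).constr_basis ℕ (fun k : β →₀ ℕ => ∏ b, w (k b)) k
    simpa only [MvPolynomial.coe_basisMonomials] using this
  have h : (∑ b : β, (MvPolynomial.X b : MvPolynomial β ℕ)) ^ n =
      (∑ b : β, MvPolynomial.X b) ^ n := rfl
  conv_lhs at h => rw [Fintype.sum_pow]
  rw [sum_pow_eq_sum_piAntidiag] at h
  have h2 := congrArg L h
  rw [map_sum, map_sum] at h2
  convert h2 using 1
  · refine sum_congr rfl fun f _ => ?_
    have : ∏ i, (MvPolynomial.X (f i) : MvPolynomial β ℕ) =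
        MvPolynomial.monomial (∑ i, Finsupp.single (f i) 1) 1 := by
      rw [MvPolynomial.monomial_sum_one]; rfl
    rw [this, hL]
    refine prod_congr rfl fun b _ => ?_
    congr 1
    simp [Finsupp.single_apply, Fintype.card_subtype]
  · refine sum_congr rfl fun k _ => ?_
    have : ∏ i, (MvPolynomial.X i : MvPolynomial β ℕ) ^ k i =
        MvPolynomial.monomial (Finsupp.equivFunOnFinite.symm k) 1 := by
      rw [MvPolynomial.monomial_eq, Finsupp.prod_fintype _ _ (by simp)]
      simp
    rw [this, ← nsmul_eq_mul, map_nsmul, hL]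
    simp

open Finset in
/-- The number of permutations that fix `f`. -/
def stabCard {n : ℕ} {β : Type*} [DecidableEq β] (f : Fin n → β) : ℕ :=
  #{g : Equiv.Perm (Fin n) | f ∘ g = f}

/-- The generating series of `k ↦ (k!) ^ r`. -/
def factorialPowSeries (r : ℕ) : PowerSeries ℕ := PowerSeries.mk fun k => k.factorial ^ r

/-- The generating series of `k ↦ (k!) ^ r` without its constant term. -/
def factorialPowSeriesTail (r : ℕ) : PowerSeries ℕ :=
  PowerSeries.mk fun k => if k = 0 then 0 else k.factorial ^ r

-- The stabilizer of `f` is the product of the symmetric groups of its fibres. One of the `r + 1`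
-- factors `∏ b, (k b)!` is absorbed by the multinomial coefficient to give `n!`.
open Finset Nat in
theorem sum_stabCard_pow {β : Type*} [Fintype β] [DecidableEq β] (n r : ℕ) :
    ∑ f : Fin n → β, stabCard f ^ (r + 1) =
      n ! * PowerSeries.coeff n (factorialPowSeries r ^ Fintype.card β) := by
  have h1 : ∀ f : Fin n → β, stabCard f ^ (r + 1) =
      ∏ b, (Fintype.card {i // f i = b})! ^ (r + 1) := fun f => by
    rw [prod_pow, ← DomMulAct.stabilizer_card f, stabCard, Fintype.card_subtype]
  simp_rw [h1]
  rw [sum_prod_fiber_weight n (fun k => k ! ^ (r + 1)), ← Finset.card_univ (α := β), ← prod_const,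
    PowerSeries.coeff_prod, mul_sum]
  refine sum_nbij' (fun k => Finsupp.equivFunOnFinite.symm k) (fun l => l) ?_ ?_ ?_ ?_ ?_
  · intro k hk; simpa [mem_finsuppAntidiag] using hk
  · intro k hk; simpa [mem_finsuppAntidiag] using hk
  · intro k _; rfl
  · intro k _; ext; rfl
  · intro k hk
    have hs : ∑ b, k b = n := by simpa using hk
    have := multinomial_spec (univ : Finset β) k
    rw [hs] at this
    simp only [factorialPowSeries, PowerSeries.coeff_mk, Finsupp.equivFunOnFinite_symm_apply_apply,
      ← this, prod_pow, pow_succ, prod_mul_distrib]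
    ring

theorem factorialPowSeries_eq (r : ℕ) : factorialPowSeries r = factorialPowSeriesTail r + 1 := by
  ext k
  rcases k with _ | k <;> simp [factorialPowSeries, factorialPowSeriesTail, PowerSeries.coeff_one]

/-! ### Coefficient estimates -/

-- Log-convexity of the factorial: for a fixed sum of two arguments, both at least `c`, the product
-- is largest at the extreme split.
open Nat in
theorem factorial_add_mul_factorial_add_le (a b c : ℕ) :
    (a + c)! * (b + c)! ≤ c ! * (a + b + c)! := by
  induction a with
  | zero => simp
  | succ a ih =>
    rw [show a + 1 + c = a + c + 1 by ring, show a + 1 + b + c = a + b + c + 1 by ring,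
      factorial_succ, factorial_succ (a + b + c)]
    calc _ = (a + c + 1) * ((a + c)! * (b + c)!) := by ring
      _ ≤ (a + b + c + 1) * (c ! * (a + b + c)!) := by gcongr; omega
      _ = _ := by ring

-- The two end terms equal `M! ^ r`. By convexity an interior term is at most `(2 * (M - 1)!) ^ r`,
-- hence at most `4 / M ^ 2` of that since `r ≥ 2`; for `M ≥ 4` the interior therefore adds at most
-- one more `M! ^ r`.
open Finset Nat in
theorem sum_factorial_mul_factorial_pow_le (M r : ℕ) (hM : 1 ≤ M) (hr : 2 ≤ r) :
    ∑ k ∈ Icc 1 M, (k ! * (M + 1 - k)!) ^ r ≤ 3 * (M !) ^ r := by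
  have h1 : ∀ k ∈ Icc 1 M, (k ! * (M + 1 - k)!) ^ r ≤ M ! ^ r := fun k hk => by
    simp only [mem_Icc] at hk
    gcongr
    have := factorial_add_mul_factorial_add_le (k - 1) (M - k) 1
    rwa [show k - 1 + 1 = k by omega, show M - k + 1 = M + 1 - k by omega,
      show k - 1 + (M - k) + 1 = M by omega, factorial_one, one_mul] at this
  rcases Nat.lt_or_ge M 4 with h4 | h4
  · calc _ ≤ ∑ k ∈ Icc 1 M, M ! ^ r := sum_le_sum h1
      _ = M * M ! ^ r := by simp
      _ ≤ _ := by gcongr; omega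
  have h2 : ∀ k ∈ Icc 1 M, M ^ 2 * (k ! * (M + 1 - k)!) ^ r ≤
      (4 + ((if k = 1 then M ^ 2 else 0) + (if k = M then M ^ 2 else 0))) * M ! ^ r :=
    fun k hk => by
      have hk1 := h1 k hk
      simp only [mem_Icc] at hk
      by_cases hk' : k = 1 ∨ k = M
      · refine Nat.mul_le_mul ?_ hk1
        rcases hk' with rfl | rfl <;> simp <;> omega
      push Not at hk'
      have h := factorial_add_mul_factorial_add_le (k - 2) (M - 1 - k) 2
      rw [show k - 2 + 2 = k by omega, show M - 1 - k + 2 = M + 1 - k by omega,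
        show k - 2 + (M - 1 - k) + 2 = M - 1 by omega] at h
      have h3 : M * (k ! * (M + 1 - k)!) ≤ 2 * M ! := by
        rw [← Nat.mul_factorial_pred (show M ≠ 0 by omega)]
        calc _ ≤ M * (2 ! * (M - 1)!) := by gcongr
          _ = _ := by rw [factorial_two]; ring
      have h5 : k ! * (M + 1 - k)! ≤ M ! := (Nat.pow_le_pow_iff_left (by omega)).1 hk1
      rw [if_neg hk'.1, if_neg hk'.2]
      obtain ⟨c, rfl⟩ := Nat.exists_eq_add_of_le hr
      calc _ = (M * (k ! * (M + 1 - k)!)) ^ 2 * (k ! * (M + 1 - k)!) ^ c := by ring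
        _ ≤ (2 * M !) ^ 2 * (M !) ^ c := by gcongr
        _ = _ := by ring
  have hM2 : 0 < M ^ 2 := by positivity
  refine _root_.le_of_mul_le_mul_left ?_ hM2
  rw [mul_sum]
  refine (sum_le_sum h2).trans ?_
  rw [← sum_mul, sum_add_distrib, sum_add_distrib, sum_ite_eq', sum_ite_eq', ← mul_assoc]
  gcongr
  simp [hM]
  nlinarith

open Finset Nat in
theorem coeff_factorialPowSeriesTail_pow_of_lt (r t n : ℕ) (h : n < t) :
    PowerSeries.coeff n (factorialPowSeriesTail r ^ t) = 0 := by
  apply PowerSeries.coeff_of_lt_order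
  refine lt_of_lt_of_le ?_ (PowerSeries.le_order_pow_of_constantCoeff_eq_zero t ?_)
  · exact_mod_cast h
  · simp [factorialPowSeriesTail, ← PowerSeries.coeff_zero_eq_constantCoeff_apply]

-- The extremal composition of `n` has one large part `n - t` and `t` parts equal to `1`; each
-- further convolution costs a factor `3`.
open Finset Nat in
theorem coeff_factorialPowSeriesTail_pow_le (r : ℕ) (hr : 2 ≤ r) (t : ℕ) :
    ∀ n, t + 1 ≤ n → PowerSeries.coeff n (factorialPowSeriesTail r ^ (t + 1)) ≤
      3 ^ t * ((n - t)!) ^ r := by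
  induction t with
  | zero => 
    intro n hn
    simp [factorialPowSeriesTail]
    split_ifs <;> simp
  | succ t ih =>
    intro n hn
    rw [pow_succ' (factorialPowSeriesTail r), PowerSeries.coeff_mul, Finset.Nat.sum_antidiagonal_eq_sum_range_succ
      (fun a b => PowerSeries.coeff a (factorialPowSeriesTail r) *
        PowerSeries.coeff b (factorialPowSeriesTail r ^ (t + 1)))]
    -- Other indices contribute nothing: the tail has no constant term, and its `(t + 1)`-st power
    -- starts in degree `t + 1`.
    have hsub : Icc 1 (n - (t + 1)) ⊆ range n.succ := fun k hk => by
      simp only [mem_Icc, mem_range] at *; omega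
    rw [← sum_subset hsub]
    · calc _ ≤ ∑ k ∈ Icc 1 (n - (t + 1)), 3 ^ t * (k ! * (n - (t + 1) + 1 - k)!) ^ r := by
            refine sum_le_sum fun k hk => ?_
            simp only [mem_Icc] at hk
            have := ih (n - k) (by omega)
            rw [show n - (t + 1) + 1 - k = n - k - t by omega]
            calc _ ≤ k ! ^ r * (3 ^ t * (n - k - t)! ^ r) := by
                  gcongr
                  simp [factorialPowSeriesTail, show k ≠ 0 by omega]
              _ = _ := by ring
        _ ≤ 3 ^ t * (3 * (n - (t + 1))! ^ r) := by
            rw [← mul_sum]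
            gcongr
            exact sum_factorial_mul_factorial_pow_le _ _ (by omega) hr
        _ = _ := by ring
    · intro k hk hk'
      simp only [mem_Icc, mem_range, not_and_or] at *
      rcases Nat.eq_zero_or_pos k with rfl | hk0
      · simp [factorialPowSeriesTail]
      · rw [coeff_factorialPowSeriesTail_pow_of_lt _ _ (n - k) (by omega), mul_zero]

-- By induction on `n`, since `(1 + 1 / n) ^ s ≤ e` for `s ≤ n`. This is the source of `e` in the
-- security parameter.
open Nat in
theorem pow_le_exp_pow_mul_descFactorial (s n : ℕ) (h : s ≤ n) :
    (n : ℝ) ^ s ≤ Real.exp 1 ^ s * n.descFactorial s := by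
  induction n generalizing s with
  | zero => obtain rfl : s = 0 := by omega
            simp
  | succ n ih =>
    rcases s with _ | s
    · simp
    · have h1 := ih s (by omega)
      rw [succ_descFactorial_succ]
      rcases Nat.eq_zero_or_pos n with rfl | hn
      · obtain rfl : s = 0 := by omega
        simp
      have hn' : (0 : ℝ) < n := by exact_mod_cast hn
      have h2 : ((n : ℝ) + 1) ^ s ≤ Real.exp 1 * (n : ℝ) ^ s := by
        have : (n : ℝ) + 1 = (1 / n + 1) * n := by field_simp; ring
        rw [this, mul_pow]
        gcongr
        calc (1 / (n : ℝ) + 1) ^ s ≤ Real.exp (1 / n) ^ s := by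
              gcongr; exact Real.add_one_le_exp _
          _ = Real.exp (s * (1 / n)) := by rw [Real.exp_nat_mul]
          _ ≤ Real.exp 1 := by
              apply Real.exp_le_exp.2
              rw [mul_one_div, div_le_one hn']
              exact_mod_cast (by omega : s ≤ n)
      push_cast
      calc ((n : ℝ) + 1) ^ (s + 1) = (n + 1) * ((n : ℝ) + 1) ^ s := by ring
        _ ≤ (n + 1) * (Real.exp 1 * (Real.exp 1 ^ s * n.descFactorial s)) := by
            gcongr
            exact h2.trans (by gcongr)
        _ = _ := by ring

open Finset Nat in
theorem choose_mul_coeff_tail_le (q n r s : ℕ) (hn : 1 ≤ n) (hr : 2 ≤ r) :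
    (q.choose (s + 1) : ℝ) * (PowerSeries.coeff n (factorialPowSeriesTail r ^ (s + 1)) : ℕ) ≤
      (n ! : ℝ) ^ r * (q * ((3 * (q * (Real.exp 1 / n) ^ r)) ^ s / (s + 1)!)) := by
  have hn0 : (0 : ℝ) < n := by exact_mod_cast hn
  rcases Nat.lt_or_ge n (s + 1) with h | h
  · rw [coeff_factorialPowSeriesTail_pow_of_lt _ _ _ h]
    simp only [Nat.cast_zero, mul_zero]
    positivity
  have h1 : ((PowerSeries.coeff n (factorialPowSeriesTail r ^ (s + 1)) : ℕ) : ℝ) ≤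
      3 ^ s * ((n - s)! : ℝ) ^ r := by
    exact_mod_cast coeff_factorialPowSeriesTail_pow_le r hr s n h
  have h2 : ((n - s)! : ℝ) ≤ (Real.exp 1 / n) ^ s * n ! := by
    have h3 := pow_le_exp_pow_mul_descFactorial s n (by omega)
    rw [← factorial_mul_descFactorial (show s ≤ n by omega), div_pow, div_mul_eq_mul_div,
      le_div_iff₀ (by positivity)]
    push_cast
    calc ((n - s)! : ℝ) * n ^ s ≤ (n - s)! * (Real.exp 1 ^ s * n.descFactorial s) := by gcongr
      _ = _ := by ring
  calc _ ≤ ((q : ℝ) ^ (s + 1) / (s + 1)!) * (3 ^ s * ((Real.exp 1 / n) ^ s * n !) ^ r) := by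
        refine mul_le_mul (choose_le_pow_div _ _) (h1.trans ?_) (by positivity) (by positivity)
        gcongr
    _ = _ := by
        rw [mul_pow 3, mul_pow, mul_pow (q : ℝ), ← pow_mul, ← pow_mul, mul_comm s r]
        ring

open Finset Nat in
theorem sum_pow_div_factorial_le (u : ℝ) (hu0 : 0 ≤ u) (hu : u ≤ 1 / 4) (q : ℕ) :
    ∑ s ∈ range q, (3 * u) ^ s / ((s + 1)! : ℝ) ≤ 1 + 2 * u := by
  -- Uses `(s + 2)! ≥ 2 * 3 ^ s`; the geometric series of ratio `1 / 4` then has sum at most `4 /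
  -- 3`, and `3 / 2 * 4 / 3 = 2`.
  have h1 : ∀ s : ℕ, (3 * u) ^ (s + 1) / ((s + 1 + 1)! : ℝ) ≤ (3 / 2 * u) * (1 / 4) ^ s := by
    intro s
    have h : (2 : ℝ) * 3 ^ s ≤ (s + 1 + 1)! := by
      have := @factorial_mul_pow_le_factorial 2 s
      rw [add_comm 2 s, factorial_two] at this
      exact_mod_cast this
    calc _ ≤ (3 * u) ^ (s + 1) / (2 * 3 ^ s) := by gcongr
      _ = (3 / 2 * u) * u ^ s := by
        rw [pow_succ, mul_pow]; field_simp
      _ ≤ _ := by gcongr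
  rcases q with _ | q
  · simp; linarith
  rw [sum_range_succ']
  have h2 : ∑ s ∈ range q, (1 / 4 : ℝ) ^ s ≤ 4 / 3 := by
    rw [geom_sum_eq (by norm_num), div_le_iff_of_neg (by norm_num)]
    have : (0 : ℝ) ≤ (1 / 4) ^ q := by positivity
    linarith
  have h3 : ∑ s ∈ range q, (3 * u) ^ (s + 1) / ((s + 1 + 1)! : ℝ) ≤ 2 * u := by
    refine (sum_le_sum fun s _ => h1 s).trans ?_
    rw [← mul_sum]
    calc _ ≤ 3 / 2 * u * (4 / 3) := by gcongr
      _ = _ := by ring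
  simp
  linarith

open Finset Nat in
theorem coeff_factorialPowSeries_pow_le (q n r : ℕ) (hn : 1 ≤ n) (hr : 2 ≤ r)
    (hu : q * (Real.exp 1 / n) ^ r ≤ 1 / 4) :
    ((PowerSeries.coeff n (factorialPowSeries r ^ q) : ℕ) : ℝ) ≤
      (n ! : ℝ) ^ r * (q * (1 + 2 * (q * (Real.exp 1 / n) ^ r))) := by
  have h : PowerSeries.coeff n (factorialPowSeries r ^ q) =
      ∑ s ∈ range q, q.choose (s + 1) *
        PowerSeries.coeff n (factorialPowSeriesTail r ^ (s + 1)) := by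
    rw [factorialPowSeries_eq, add_pow, map_sum, sum_range_succ']
    simp only [one_pow, mul_one, pow_zero, one_mul]
    simp only [mul_comm _ (Nat.cast _ : PowerSeries ℕ), ← nsmul_eq_mul, map_nsmul]
    simp [PowerSeries.coeff_one, show n ≠ 0 by omega]
  rw [h]
  push_cast
  calc _ ≤ ∑ s ∈ range q,
        (n ! : ℝ) ^ r * (q * ((3 * (q * (Real.exp 1 / n) ^ r)) ^ s / (s + 1)!)) :=
        sum_le_sum fun s _ => choose_mul_coeff_tail_le q n r s hn hr
    _ = (n ! : ℝ) ^ r * (q * ∑ s ∈ range q, (3 * (q * (Real.exp 1 / n) ^ r)) ^ s / (s + 1)!) := by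
        rw [mul_sum, mul_sum]
    _ ≤ _ := by
        gcongr
        exact sum_pow_div_factorial_le _ (by positivity) hu q

theorem prod_sum_eq_sum_prod {ι α R : Type*} [Fintype ι] [DecidableEq ι] [Fintype α]
    [CommSemiring R] (F : ι → α → R) : ∏ i, ∑ a, F i a = ∑ f : ι → α, ∏ i, F i (f i) := by
  rw [Finset.prod_univ_sum, Fintype.piFinset_univ]

/-! ### The output law as a count of permutations -/

open Finset

theorem card_shareTuples {G : Type*} [AddCommGroup G] [Fintype G] [DecidableEq G]
    (m : ℕ) (x : G) : #(shareTuples (m + 1) x) = Fintype.card G ^ m := by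
  rw [← Fintype.card_fin m, ← Fintype.card_fun, Fintype.card_fin, ← Finset.card_univ]
  refine card_nbij' (fun y i => y i.succ) (fun z => Fin.cons (x - ∑ i, z i) z) ?_ ?_ ?_ ?_
  · simp
  · intro z _
    simp [shareTuples, Fin.sum_univ_succ]
  · intro y hy
    simp only [shareTuples, coe_filter, mem_univ, true_and, Set.mem_ofPred_eq,
      Fin.sum_univ_succ] at hy
    ext i
    refine Fin.cases ?_ (fun i => ?_) i
    · simp [← hy]
    · simp
  · intro z _
    simp

/-- The number of families of permutations that unshuffle `v` to shares of `x`. -/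
def unshuffleCount {G : Type*} [AddCommGroup G] [DecidableEq G] {m n : ℕ}
    (x : Fin n → G) (v : Fin m → Fin n → G) : ℕ :=
  #{π : Fin m → Equiv.Perm (Fin n) | ∀ i, ∑ j, v j ((π j)⁻¹ i) = x i}

theorem shuffler_apply {G : Type*} [DecidableEq G] (n : ℕ) (y w : Fin n → G) :
    shuffler n y w = (n.factorial : ENNReal)⁻¹ *
      (#{π : Equiv.Perm (Fin n) | w = fun i => y (π i)} : ℕ) := by
  rw [shuffler, PMF.map_apply, tsum_fintype]
  simp [← sum_filter, Fintype.card_perm, mul_comm]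

theorem sum_eq_of_unshuffleCount_ne_zero {G : Type*} [AddCommGroup G] [DecidableEq G]
    {m n : ℕ} {x : Fin n → G} {v : Fin m → Fin n → G}
    (h : unshuffleCount x v ≠ 0) : ∑ i, x i = ∑ j, ∑ i, v j i := by
  rw [unshuffleCount, card_ne_zero] at h
  obtain ⟨π, hπ⟩ := h
  simp only [mem_filter, mem_univ, true_and] at hπ
  simp_rw [← hπ]
  rw [sum_comm]
  exact sum_congr rfl fun j _ => Equiv.sum_comp (π j)⁻¹ (v j)

section Protocol

variable {G : Type*} [AddCommGroup G] [Fintype G] [DecidableEq G] {m n : ℕ}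

/-- Given the output, a family of permutations determines the shares before shuffling, so each
family is counted for at most one `y`. -/
theorem unshuffleCount_eq (x : Fin n → G) (v : Fin m → Fin n → G) :
    unshuffleCount x v = ∑ y : Fin n → Fin m → G, if ∀ i, y i ∈ shareTuples m (x i) then
      ∏ j, #{π : Equiv.Perm (Fin n) | v j = fun i => y (π i) j} else 0 := by
  simp_rw [← Fintype.card_piFinset]
  have h1 : ∀ y : Fin n → Fin m → G, (if ∀ i, y i ∈ shareTuples m (x i) then
      #(Fintype.piFinset fun j => {π : Equiv.Perm (Fin n) | v j = fun i => y (π i) j}) else 0) =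
      ∑ π : Fin m → Equiv.Perm (Fin n),
        if (∀ i, ∑ j, v j ((π j)⁻¹ i) = x i) ∧ y = fun i j => v j ((π j)⁻¹ i) then 1 else 0 := by
    intro y
    rw [← card_filter]
    split_ifs with h
    · congr 1
      ext π
      simp only [shareTuples, mem_filter, mem_univ, true_and] at h
      simp only [Fintype.mem_piFinset, mem_filter, mem_univ, true_and]
      constructor
      · intro hv
        have : y = fun i j => v j ((π j)⁻¹ i) := by
          ext i j; rw [hv j]; simp
        refine ⟨fun i => ?_, this⟩
        rw [← h i, this]
      · rintro ⟨_, rfl⟩ j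
        ext i; simp
    · symm
      rw [card_eq_zero, filter_eq_empty_iff]
      rintro π _ ⟨h1, rfl⟩
      exact h fun i => by simpa [shareTuples] using h1 i
  simp_rw [h1]
  rw [sum_comm, unshuffleCount, card_filter]
  refine sum_congr rfl fun π _ => ?_
  simp [ite_and]

theorem parallelIKOS_apply (x : Fin n → G) (v : Fin (m + 1) → Fin n → G) :
    parallelIKOS G (m + 1) n x v = (((Fintype.card G ^ m : ℕ) : ENNReal)⁻¹) ^ n *
      ((n.factorial : ENNReal)⁻¹) ^ (m + 1) * (unshuffleCount x v : ℕ) := by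
  rw [parallelIKOS, PMF.bind_apply, tsum_fintype, unshuffleCount_eq, Nat.cast_sum, mul_sum]
  refine sum_congr rfl fun y _ => ?_
  simp only [indepPMF, PMF.ofFintype_apply, shuffler_apply, shareRandomizer,
    PMF.uniformOfFinset_apply, card_shareTuples]
  rw [Finset.prod_mul_distrib, Finset.prod_ite_zero]
  simp only [mem_univ, forall_const]
  split_ifs
  · simp [mul_assoc]
  · simp

theorem parallelIKOS_apply_toReal (x : Fin n → G) (v : Fin (m + 1) → Fin n → G) :
    (parallelIKOS G (m + 1) n x v).toReal =
      unshuffleCount x v / ((Fintype.card G : ℝ) ^ (m * n) * (n.factorial : ℝ) ^ (m + 1)) := by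
  rw [parallelIKOS_apply]
  simp [pow_mul]
  field_simp

theorem sum_unshuffleCount (v : Fin m → Fin n → G) :
    ∑ x : Fin n → G, unshuffleCount x v = n.factorial ^ m := by
  simp_rw [unshuffleCount, card_filter, ← funext_iff (g := fun i => _)]
  rw [sum_comm]
  simp [Fintype.card_perm]

theorem sum_unshuffleCount_sq (v : Fin m → Fin n → G) :
    ∑ x : Fin n → G, unshuffleCount x v ^ 2 = ∑ π : Fin m → Equiv.Perm (Fin n),
      ∑ ρ : Fin m → Equiv.Perm (Fin n),
        if ∀ i, ∑ j, v j ((π j)⁻¹ i) = ∑ j, v j ((ρ j)⁻¹ i) then 1 else 0 := by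
  simp_rw [unshuffleCount, card_filter, sq, sum_mul_sum]
  rw [sum_comm]
  refine sum_congr rfl fun π _ => ?_
  rw [sum_comm]
  refine sum_congr rfl fun ρ _ => ?_
  rw [sum_eq_single fun i => ∑ j, v j ((π j)⁻¹ i)]
  · simp [eq_comm]
  · intro x _ hx
    rw [if_neg, zero_mul]
    exact fun h => hx (funext fun i => (h i).symm)
  · simp

end Protocol

/-! ### The second moment by duality -/

theorem card_perm_comp_eq {n : ℕ} {β : Type*} [DecidableEq β] (f : Fin n → β)
    (π : Equiv.Perm (Fin n)) : #{ρ : Equiv.Perm (Fin n) | f ∘ π = f ∘ ρ} = stabCard f := by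
  refine card_nbij' (fun ρ => ρ * π⁻¹) (fun g => g * π) ?_ ?_ ?_ ?_
  · intro ρ hρ
    simp only [coe_filter, mem_univ, true_and, Set.mem_ofPred_eq] at hρ ⊢
    rw [Equiv.Perm.coe_mul, ← Function.comp_assoc, ← hρ]
    ext i; simp
  · intro g hg
    simp only [coe_filter, mem_univ, true_and, Set.mem_ofPred_eq] at hg ⊢
    rw [Equiv.Perm.coe_mul, ← Function.comp_assoc, hg]
  · intro ρ _; simp
  · intro ρ _; simp

theorem sum_card_invariant {n m : ℕ} {β : Type*} [Fintype β] [DecidableEq β] :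
    ∑ π : Fin m → Equiv.Perm (Fin n), ∑ ρ : Fin m → Equiv.Perm (Fin n),
      #{f : Fin n → β | ∀ j, f ∘ π j = f ∘ ρ j} =
    n.factorial ^ m * ∑ f : Fin n → β, stabCard f ^ m := by
  simp_rw [card_filter]
  have : ∀ π : Fin m → Equiv.Perm (Fin n), ∑ ρ : Fin m → Equiv.Perm (Fin n),
      ∑ f : Fin n → β, (if ∀ j, f ∘ π j = f ∘ ρ j then 1 else 0) =
      ∑ f : Fin n → β, stabCard f ^ m := by
    intro π
    rw [sum_comm]
    refine sum_congr rfl fun f _ => ?_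
    have h := Fintype.card_piFinset
      (fun j => ({ρ : Equiv.Perm (Fin n) | f ∘ π j = f ∘ ρ} : Finset _))
    simp_rw [card_perm_comp_eq] at h
    rw [← card_filter]
    simp only [prod_const, Finset.card_univ, Fintype.card_fin] at h
    rw [← h]
    congr 1
    ext ρ
    simp
  simp_rw [this]
  simp [Fintype.card_perm]

/-- The two sets are the kernels of a linear map from `m × n` arrays to `n`-tuples and of its
transpose `f ↦ (f ∘ π j - f ∘ ρ j)`. Both sides evaluate the double sum of `ψ` of the pairing of `f`
with the image of `v`, summed over `f` first or over `v` first. -/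
theorem card_rows_eq {q : ℕ} [NeZero q] {m n : ℕ} (π ρ : Fin m → Equiv.Perm (Fin n)) :
    q ^ n * #{v : Fin m → Fin n → ZMod q |
        ∀ i, ∑ j, v j ((π j)⁻¹ i) = ∑ j, v j ((ρ j)⁻¹ i)} =
      q ^ (n * m) * #{f : Fin n → ZMod q | ∀ j, f ∘ π j = f ∘ ρ j} := by
  have hψ := ZMod.isPrimitive_stdAddChar q
  set ψ := ZMod.stdAddChar (N := q)
  have hsum : ∀ b : ZMod q, ∑ a, ψ (a * b) = if b = 0 then (q : ℂ) else 0 := fun b => by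
    rw [AddChar.sum_mulShift b hψ, ZMod.card]; simp
  have hprod : ∀ {ι : Type} [Fintype ι] (g : ι → ZMod q), ψ (∑ i, g i) = ∏ i, ψ (g i) :=
    fun g => map_prod ψ.toMonoidHom (fun i => Multiplicative.ofAdd (g i)) univ
  have hswap : ∀ (f : Fin n → ZMod q) (v : Fin m → Fin n → ZMod q),
      ∑ i, f i * (∑ j, v j ((π j)⁻¹ i) - ∑ j, v j ((ρ j)⁻¹ i)) =
      ∑ j, ∑ i, v j i * (f (π j i) - f (ρ j i)) := by
    intro f v
    have h : ∀ (σ : Fin m → Equiv.Perm (Fin n)), ∑ i, f i * ∑ j, v j ((σ j)⁻¹ i) =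
        ∑ j, ∑ i, v j i * f (σ j i) := by
      intro σ
      simp_rw [mul_sum]
      rw [sum_comm]
      refine sum_congr rfl fun j _ => ?_
      rw [← Equiv.sum_comp (σ j)]
      simp [mul_comm]
    simp_rw [mul_sub, sum_sub_distrib, h]
  have key : ((q ^ n * #{v : Fin m → Fin n → ZMod q |
        ∀ i, ∑ j, v j ((π j)⁻¹ i) = ∑ j, v j ((ρ j)⁻¹ i)} : ℕ) : ℂ) =
      ((q ^ (n * m) * #{f : Fin n → ZMod q | ∀ j, f ∘ π j = f ∘ ρ j} : ℕ) : ℂ) := by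
    calc _ = ∑ v : Fin m → Fin n → ZMod q, ∏ i : Fin n,
          (if ∑ j, v j ((π j)⁻¹ i) - ∑ j, v j ((ρ j)⁻¹ i) = 0 then (q : ℂ) else 0) := by
          rw [card_filter]
          push_cast
          rw [mul_sum]
          refine sum_congr rfl fun v _ => ?_
          rw [prod_ite_zero]
          simp [sub_eq_zero]
      _ = ∑ v : Fin m → Fin n → ZMod q, ∑ f : Fin n → ZMod q,
          ψ (∑ i, f i * (∑ j, v j ((π j)⁻¹ i) - ∑ j, v j ((ρ j)⁻¹ i))) := by
          refine sum_congr rfl fun v _ => ?_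
          simp_rw [← hsum, prod_sum_eq_sum_prod, hprod]
      _ = ∑ f : Fin n → ZMod q, ∏ j : Fin m, ∏ i : Fin n,
          (if f (π j i) - f (ρ j i) = 0 then (q : ℂ) else 0) := by
          rw [sum_comm]
          refine sum_congr rfl fun f _ => ?_
          simp_rw [hswap, ← hsum, prod_sum_eq_sum_prod, hprod]
      _ = _ := by
          rw [card_filter]
          push_cast
          rw [mul_sum]
          refine sum_congr rfl fun f _ => ?_
          simp_rw [prod_ite_zero]
          simp [sub_eq_zero, funext_iff, pow_mul, prod_ite_zero]
  exact_mod_cast key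

theorem sum_sum_unshuffleCount_sq (q : ℕ) [NeZero q] (m n : ℕ) :
    q ^ n * ∑ v : Fin m → Fin n → ZMod q, ∑ x, unshuffleCount x v ^ 2 =
      q ^ (n * m) * (n.factorial ^ m * ∑ f : Fin n → ZMod q, stabCard f ^ m) := by
  simp_rw [sum_unshuffleCount_sq]
  rw [← sum_card_invariant, sum_comm, mul_sum, mul_sum]
  refine sum_congr rfl fun π _ => ?_
  rw [sum_comm, mul_sum, mul_sum]
  refine sum_congr rfl fun ρ _ => ?_
  rw [← card_rows_eq, card_filter]
-- From the second moment to total variation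
theorem tvDistance_le {Ω : Type*} [Fintype Ω] (P Q : PMF Ω) :
    tvDistance P Q ≤ (∑ v, |(P v).toReal - (Q v).toReal|) / 2 := by
  classical
  have hmeas : ∀ (R : PMF Ω) (E : Set Ω),
      (R.toOuterMeasure E).toReal = ∑ v, if v ∈ E then (R v).toReal else 0 := by
    intro R E
    rw [PMF.toOuterMeasure_apply_fintype, ENNReal.toReal_sum]
    · refine sum_congr rfl fun v _ => ?_
      rw [Set.indicator_apply]
      split_ifs <;> simp
    · intro v _
      rw [Set.indicator_apply]
      split_ifs <;> simp [R.apply_ne_top]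
  have hone : ∀ R : PMF Ω, ∑ v, (R v).toReal = 1 := fun R => by
    rw [← ENNReal.toReal_sum fun v _ => R.apply_ne_top v, ← tsum_fintype (L := .unconditional _),
      R.tsum_coe, ENNReal.toReal_one]
  refine ciSup_le fun E => ?_
  rw [hmeas, hmeas, ← sum_sub_distrib]
  have h0 : ∑ v, ((P v).toReal - (Q v).toReal) = 0 := by
    rw [sum_sub_distrib, hone, hone, sub_self]
  -- Both masses are `1`, so twice the difference on `E` is a sum with signs `+1` on `E` and `-1`
  -- off it; this gives the factor `1 / 2`.
  have h1 : 2 * ∑ v, ((if v ∈ E then (P v).toReal else 0) - if v ∈ E then (Q v).toReal else 0) =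
      ∑ v, (if v ∈ E then (1 : ℝ) else -1) * ((P v).toReal - (Q v).toReal) := by
    rw [← sub_zero (2 * _), ← h0, mul_sum, ← sum_sub_distrib]
    refine sum_congr rfl fun v _ => ?_
    split_ifs <;> ring
  rw [le_div_iff₀ two_pos, mul_comm, ← abs_two, ← abs_mul, h1]
  refine (abs_sum_le_sum_abs _ _).trans (sum_le_sum fun v _ => ?_)
  rw [abs_mul]
  split_ifs <;> simp

/-- Second moment bound for the average `ℓ¹` distance between the rows of `P`, the average being
over pairs of rows in the same fibre of `s`, when the rows in different fibres of `s` have their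
supports in different fibres of `t`. -/
theorem sq_sum_abs_sub_le {X Ω G : Type*} [Fintype X] [Fintype Ω] [Fintype G] [DecidableEq G]
    (s : X → G) (t : Ω → G) (P : X → Ω → ℝ) (a b : ℕ) (c : ℝ)
    (hs : ∀ g, #{x | s x = g} = a) (ht : ∀ g, #{v | t v = g} = b)
    (hP : ∀ x v, P x v ≠ 0 → s x = t v) (hc : ∀ v, ∑ x, P x v = c) :
    (∑ p : X × X with s p.1 = s p.2, ∑ v, |P p.1 v - P p.2 v|) ^ 2 ≤
      (Fintype.card X * a * b) *
        (2 * a * ∑ v, ∑ x, P x v ^ 2 - 2 * Fintype.card Ω * c ^ 2) := by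
  classical
  -- Off `T` both rows vanish at `v`, so Cauchy–Schwarz only pays for `#T`; allowing every `v` would
  -- replace `b` by the whole of `Ω`.
  set T : Finset ((X × X) × Ω) := {p | s p.1.1 = s p.1.2 ∧ s p.1.1 = t p.2} with hT
  have hite : ∀ F : (X × X) → Ω → ℝ, (∀ p v, s p.1 = s p.2 → s p.1 ≠ t v → F p v = 0) →
      ∑ p : X × X with s p.1 = s p.2, ∑ v, F p v = ∑ z ∈ T, F z.1 z.2 := by
    intro F hF
    have hR : ∑ z ∈ T, F z.1 z.2 = ∑ p : X × X, ∑ v,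
        if s p.1 = s p.2 ∧ s p.1 = t v then F p v else 0 := by
      rw [hT, sum_filter, Fintype.sum_prod_type]
    rw [hR, sum_filter]
    refine sum_congr rfl fun p _ => ?_
    split_ifs with h
    · refine sum_congr rfl fun v _ => ?_
      split_ifs with h'
      · rfl
      · exact hF p v h fun h2 => h' ⟨h, h2⟩
    · simp [h]
  have hz : ∀ x v, s x ≠ t v → P x v = 0 := fun x v h => by
    by_contra h'
    exact h (hP x v h')
  have hcard : #T = Fintype.card X * a * b := by
    rw [hT, card_filter, Fintype.sum_prod_type, Fintype.sum_prod_type]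
    simp only [ite_and]
    have h1 : ∀ x y, ∑ v, (if s x = s y then if s x = t v then 1 else 0 else 0) =
        if s x = s y then b else 0 := by
      intro x y
      split_ifs
      · rw [← ht (s x), card_filter]
        simp_rw [eq_comm]
      · simp
    simp_rw [h1]
    have h2 : ∀ x, ∑ y, (if s x = s y then b else 0) = a * b := by
      intro x
      rw [← sum_filter, sum_const, smul_eq_mul, ← hs (s x)]
      simp_rw [eq_comm]
    simp_rw [h2]
    simp [mul_assoc]
  have hfib : ∀ x, ∑ y, (if s x = s y then (1 : ℝ) else 0) = a := by
    intro x
    rw [← hs (s x), card_filter]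
    push_cast
    simp_rw [eq_comm]
  have hsq : ∑ p : X × X with s p.1 = s p.2, ∑ v, |P p.1 v - P p.2 v| ^ 2 =
      2 * a * ∑ v, ∑ x, P x v ^ 2 - 2 * Fintype.card Ω * c ^ 2 := by
    rw [sum_comm]
    have h1 : ∀ v, ∑ p : X × X with s p.1 = s p.2, |P p.1 v - P p.2 v| ^ 2 =
        2 * a * ∑ x, P x v ^ 2 - 2 * c ^ 2 := by
      intro v
      -- For `x`, `y` in different fibres one of `P x v`, `P y v` is zero, so the cross term needs
      -- no fibre condition and sums to `c ^ 2`.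
      have h2 : ∀ x y, (if s x = s y then |P x v - P y v| ^ 2 else 0) =
          P x v ^ 2 * (if s x = s y then 1 else 0) + P y v ^ 2 * (if s y = s x then 1 else 0) -
            2 * (P x v * P y v) := by
        intro x y
        rw [sq_abs]
        by_cases h : s x = s y
        · simp only [h, if_true]; ring
        · have h' : ¬ s y = s x := fun h' => h h'.symm
          simp only [h, h', if_false]
          by_cases hx : s x = t v
          · rw [hz y v (fun hy => h (hx.trans hy.symm))]; ring
          · rw [hz x v hx]; ring
      rw [sum_filter, Fintype.sum_prod_type]
      have hA : ∑ x, ∑ y, P x v ^ 2 * (if s x = s y then (1 : ℝ) else 0) =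
          a * ∑ x, P x v ^ 2 := by
        rw [mul_sum]
        exact sum_congr rfl fun x _ => by rw [← mul_sum, hfib, mul_comm]
      have hC : ∑ x, ∑ y, 2 * (P x v * P y v) = 2 * c ^ 2 := by
        simp_rw [← mul_sum, hc, ← sum_mul, hc, sq]
      simp_rw [h2, sum_sub_distrib, sum_add_distrib]
      rw [hC, hA, sum_comm, hA]
      ring
    simp_rw [h1]
    rw [sum_sub_distrib, ← mul_sum]
    simp
    ring
  rw [← hsq, hite _ fun p v h h' => by rw [hz _ _ h', hz _ _ (h ▸ h'), sub_self, abs_zero],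
    hite (fun p v => |P p.1 v - P p.2 v| ^ 2)
      fun p v h h' => by rw [hz _ _ h', hz _ _ (h ▸ h'), sub_self, abs_zero, sq, zero_mul]]
  have := sq_sum_le_card_mul_sum_sq (s := T) (f := fun z => |P z.1.1 z.2 - P z.1.2 z.2|)
  rw [hcard] at this
  exact_mod_cast this

theorem card_fiber_mul_card {H G : Type*} [AddCommGroup H] [Fintype H] [AddCommGroup G]
    [Fintype G] [DecidableEq G] (φ : H →+ G) (hφ : Function.Surjective φ) (g : G) :
    Fintype.card G * #{x | φ x = g} = Fintype.card H := by
  have h := fun g' => AddMonoidHom.card_fiber_eq_of_mem_range φ (hφ g') (hφ g)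
  have h2 := card_eq_sum_card_fiberwise (s := (univ : Finset H)) (f := φ) (t := univ) (by simp)
  simp_rw [h] at h2
  simpa using h2.symm
theorem sq_expectation_tvDistance_le (q m n : ℕ) [NeZero q] (hn : 1 ≤ n) (hm : 2 ≤ m)
    (hu : (q : ℝ) * (Real.exp 1 / n) ^ m ≤ 1 / 4) :
    (∑ p : (Fin n → ZMod q) × (Fin n → ZMod q), (inputPairLaw (ZMod q) n p).toReal *
      tvDistance (parallelIKOS (ZMod q) (m + 1) n p.1) (parallelIKOS (ZMod q) (m + 1) n p.2)) ^ 2 ≤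
      q * (Real.exp 1 / n) ^ m := by
  set u : ℝ := q * (Real.exp 1 / n) ^ m with hudef
  have hq : 0 < q := Nat.pos_of_ne_zero (NeZero.ne q)
  have : NeZero n := ⟨by omega⟩
  let φ : (Fin n → ZMod q) →+ ZMod q :=
    { toFun := fun x => ∑ i, x i
      map_zero' := by simp
      map_add' := fun x y => by simp [sum_add_distrib] }
  let χ : (Fin (m + 1) → Fin n → ZMod q) →+ ZMod q :=
    { toFun := fun v => ∑ j, ∑ i, v j i
      map_zero' := by simp
      map_add' := fun x y => by simp [sum_add_distrib] }
  have hφ : Function.Surjective φ := fun g => ⟨Pi.single 0 g, by simp [φ]⟩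
  have hχ : Function.Surjective χ := fun g => ⟨Pi.single 0 (Pi.single 0 g), by
    show ∑ j, ∑ i, (Pi.single 0 (Pi.single 0 g) : Fin (m + 1) → Fin n → ZMod q) j i = g
    rw [sum_eq_single 0 (fun j _ hj => by simp [hj]) (by simp)]
    simp⟩
  set a : ℕ := #{x | φ x = 0} with ha
  set b : ℕ := #{v | χ v = 0} with hb
  have hs : ∀ g, #{x | φ x = g} = a := fun g =>
    AddMonoidHom.card_fiber_eq_of_mem_range φ (hφ g) (hφ 0)
  have ht : ∀ g, #{v | χ v = g} = b := fun g =>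
    AddMonoidHom.card_fiber_eq_of_mem_range χ (hχ g) (hχ 0)
  have hqa : (q : ℝ) * a = q ^ n := by
    have := card_fiber_mul_card φ hφ 0
    simp only [ZMod.card, Fintype.card_fun, Fintype.card_fin] at this
    exact_mod_cast this
  have hqb : (q : ℝ) * b = q ^ n * q ^ (m * n) := by
    have := card_fiber_mul_card χ hχ 0
    simp only [ZMod.card, Fintype.card_fun, Fintype.card_fin] at this
    rw [← pow_add, show n + m * n = n * (m + 1) by ring, pow_mul]
    exact_mod_cast this
  set A : ℝ := (q : ℝ) ^ n with hA
  set C : ℝ := (q : ℝ) ^ (m * n) with hC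
  set F : ℝ := (n.factorial : ℝ) ^ (m + 1) with hF
  have hq' : (0 : ℝ) < q := by exact_mod_cast hq
  have hApos : 0 < A := by positivity
  have hCpos : 0 < C := by positivity
  have hFpos : 0 < F := by
    have : (0 : ℝ) < n.factorial := by exact_mod_cast n.factorial_pos
    positivity
  have hapos : (0 : ℝ) < a := by nlinarith
  let P : (Fin n → ZMod q) → (Fin (m + 1) → Fin n → ZMod q) → ℝ := fun x v =>
    unshuffleCount x v / (C * F)
  have hP : ∀ x v, (parallelIKOS (ZMod q) (m + 1) n x v).toReal = P x v := fun x v => by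
    rw [parallelIKOS_apply_toReal, ZMod.card]
  have hsupp : ∀ x v, P x v ≠ 0 → φ x = χ v := fun x v h =>
    sum_eq_of_unshuffleCount_ne_zero fun h0 => h (by simp [P, h0])
  have hcol : ∀ v, ∑ x, P x v = 1 / C := fun v => by
    simp only [P]
    rw [← sum_div, ← Nat.cast_sum, sum_unshuffleCount]
    push_cast
    rw [← hF]
    field_simp
  have hcs := sq_sum_abs_sub_le φ χ P a b (1 / C) hs ht hsupp hcol
  have hX : (Fintype.card (Fin n → ZMod q) : ℝ) = A := by simp [hA, ZMod.card]
  have hΩ : (Fintype.card (Fin (m + 1) → Fin n → ZMod q) : ℝ) = A * C := by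
    simp only [ZMod.card, Fintype.card_fun, Fintype.card_fin]
    push_cast
    rw [hA, hC, ← pow_mul, ← pow_add]
    ring_nf
  rw [hX, hΩ] at hcs
  have hQ : A * ∑ v, ∑ x, P x v ^ 2 ≤ A * (q * (1 + 2 * u)) / C := by
    have h1 : A * ∑ v : Fin (m + 1) → Fin n → ZMod q, ∑ x, (unshuffleCount x v : ℝ) ^ 2 =
        (A * C) * (F * (n.factorial *
          (PowerSeries.coeff n (factorialPowSeries m ^ q) : ℕ))) := by
      have := sum_sum_unshuffleCount_sq q (m + 1) n
      rw [sum_stabCard_pow, ZMod.card] at this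
      rw [hA, hC, hF, ← pow_add, show n + m * n = n * (m + 1) by ring]
      exact_mod_cast this
    have h2 : (n.factorial : ℝ) * (PowerSeries.coeff n (factorialPowSeries m ^ q) : ℕ) ≤
        F * (q * (1 + 2 * u)) := by
      calc _ ≤ (n.factorial : ℝ) * ((n.factorial : ℝ) ^ m * (q * (1 + 2 * u))) := by
            gcongr
            exact coeff_factorialPowSeries_pow_le q n m hn hm hu
        _ = _ := by rw [hF]; ring
    simp only [P, div_pow]
    simp_rw [← sum_div]
    rw [← mul_div_assoc, h1]
    calc _ ≤ (A * C) * (F * (F * (q * (1 + 2 * u)))) / (C * F) ^ 2 := by gcongr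
      _ = _ := by field_simp
  have hcard : (#(equalSumPairs (ZMod q) n) : ℝ) = A * a := by
    rw [← hX, equalSumPairs, card_filter, Fintype.sum_prod_type]
    have : ∀ x : Fin n → ZMod q,
        (∑ y : Fin n → ZMod q, if ∑ i, x i = ∑ i, y i then 1 else 0) = a := by
      intro x
      rw [← hs (φ x), card_filter]
      refine sum_congr rfl fun y _ => ?_
      simp only [φ, AddMonoidHom.coe_mk, ZeroHom.coe_mk, eq_comm]
    simp_rw [this]
    simp
  set D : ℝ := ∑ p : (Fin n → ZMod q) × (Fin n → ZMod q) with φ p.1 = φ p.2,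
    ∑ v, |P p.1 v - P p.2 v| with hD
  have hE : ∑ p : (Fin n → ZMod q) × (Fin n → ZMod q), (inputPairLaw (ZMod q) n p).toReal *
      tvDistance (parallelIKOS (ZMod q) (m + 1) n p.1) (parallelIKOS (ZMod q) (m + 1) n p.2) ≤
      D / (2 * (A * a)) := by
    rw [hD, sum_filter, sum_div]
    refine sum_le_sum fun p _ => ?_
    rw [inputPairLaw, PMF.uniformOfFinset_apply]
    have hmem : p ∈ equalSumPairs (ZMod q) n ↔ φ p.1 = φ p.2 := by simp [equalSumPairs, φ]
    simp only [hmem]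
    split_ifs with h
    · have := tvDistance_le (parallelIKOS (ZMod q) (m + 1) n p.1)
        (parallelIKOS (ZMod q) (m + 1) n p.2)
      simp only [hP] at this
      rw [ENNReal.toReal_inv, ENNReal.toReal_natCast, hcard]
      calc _ ≤ (A * a)⁻¹ * ((∑ v, |P p.1 v - P p.2 v|) / 2) := by gcongr
        _ = _ := by field_simp
    · simp
  have hE0 : 0 ≤ ∑ p : (Fin n → ZMod q) × (Fin n → ZMod q), (inputPairLaw (ZMod q) n p).toReal *
      tvDistance (parallelIKOS (ZMod q) (m + 1) n p.1) (parallelIKOS (ZMod q) (m + 1) n p.2) :=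
    sum_nonneg fun p _ => mul_nonneg ENNReal.toReal_nonneg
      (Real.iSup_nonneg fun E => abs_nonneg _)
  calc _ ≤ (D / (2 * (A * a))) ^ 2 := by gcongr
    _ = D ^ 2 / (2 * (A * a)) ^ 2 := by rw [div_pow]
    _ ≤ (A * a * b) * (2 * a * (q * (1 + 2 * u) / C) - 2 * (A * C) * (1 / C) ^ 2) /
        (2 * (A * a)) ^ 2 := by
      have h3 : ∑ v, ∑ x, P x v ^ 2 ≤ q * (1 + 2 * u) / C := by
        rw [mul_div_assoc] at hQ
        exact le_of_mul_le_mul_left hQ hApos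
      gcongr
      refine hcs.trans ?_
      gcongr
    -- With `A = q * a` and `b = a * C`, the `1` in `1 + 2 * u` cancels against the squared mean and
    -- exactly `u` remains.
    _ = u := by
      have h4 : (b : ℝ) = a * C := by
        have : (q : ℝ) * b = q * (a * C) := by rw [hqb, ← hqa]; ring
        exact mul_left_cancel₀ hq'.ne' this
      rw [h4, ← hqa]
      field_simp
      ring

theorem mainTheorem2 (q m n : ℕ) [NeZero q] [NeZero m] (σ : ℝ)
    (hσ : σ = (((m : ℝ) - 1) * (Real.logb 2 (n : ℝ) - Real.logb 2 (Real.exp 1))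
      - Real.logb 2 (q : ℝ)) / 2)
    (hσ1 : 1 ≤ σ) (hm : 3 ≤ m) (hn : 19 ≤ n) :
    AverageCaseSecure (parallelIKOS (ZMod q) m n) σ := by
  obtain ⟨k, rfl⟩ : ∃ k, m = k + 1 := ⟨m - 1, by omega⟩
  have hq' : (0 : ℝ) < q := by exact_mod_cast Nat.pos_of_ne_zero (NeZero.ne q)
  have hn' : (0 : ℝ) < n := by exact_mod_cast (by omega : 0 < n)
  have hu : ((2 : ℝ) ^ (-σ)) ^ 2 = q * (Real.exp 1 / n) ^ k := by
    have hpos : 0 < (q : ℝ) * (Real.exp 1 / n) ^ k := by positivity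
    rw [← Real.rpow_natCast, ← Real.rpow_mul (by norm_num), ← Real.logb_eq_iff_rpow_eq (by norm_num)
      (by norm_num) hpos, Real.logb_mul hq'.ne' (by positivity), Real.logb_pow,
      Real.logb_div (Real.exp_pos 1).ne' hn'.ne', hσ]
    push_cast
    ring
  -- The assumption `1 ≤ σ` is what makes `u ≤ 1 / 4`, as the series estimate needs.
  have h4 : ((2 : ℝ) ^ (-σ)) ^ 2 ≤ 1 / 4 := by
    have h : (2 : ℝ) ^ (-σ) ≤ 2 ^ (-1 : ℝ) :=
      Real.rpow_le_rpow_of_exponent_le (by norm_num) (by linarith)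
    rw [Real.rpow_neg_one] at h
    calc _ ≤ (2⁻¹ : ℝ) ^ 2 := by gcongr
      _ = _ := by norm_num
  have := sq_expectation_tvDistance_le q k n (by omega) (by omega) (hu ▸ h4)
  rw [← hu] at this
  exact le_of_sq_le_sq this (by positivity)
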